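/- Let $d_x,d_y\in\mathbb N$, let $\mu$ be a Borel probability measure on $\mathbb R^{d_y}$ with finite second moment, and let $\nu$ be a Borel probability measure on $\mathbb R^{d_x+d_y}$, the law of a pair $(X,Y)$ with $\mathbb E[\|X\|^2+\|Y\|^2]<\infty$ and $\mathbb E[X]=0$. Let $\varepsilon>0$ and $c(u,y)=\tfrac12\|u-y\|^2$, let $R=\mu\otimes\nu$, and let $\tilde R$ be the probability measure on $\mathbb R^{d_y}\times\mathbb R^{d_x+d_y}$ given by $d\tilde R=\alpha^{-1}e^{-c/\varepsilon}\,dR$ with $\alpha=\int e^{-c/\varepsilon}\,dR$. Let $\tilde{\mathsf W}_1$ be the $1$-Wasserstein distance for the metric $$\tilde{\mathsf d}\big((u,x,y),(u',x',y')\big)=\min(\|u-u'\|,1)+\|x-x'\|+\min(\|y-y'\|,1)$$ on the set $\tilde{\mathcal P}_1$ of Borel probability measures $P$ on $\mathbb R^{d_y}\times\mathbb R^{d_x+d_y}$ with $\int\tilde{\mathsf d}(\cdot,0)\,dP<\infty$. Assume that (i) the matrix $\mathbb E[XX^\top]$ is invertible; and (ii) for every $0<a<\infty$ the set $\{Q\in\tilde{\mathcal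 P}_1:\mathsf{KL}(Q\,\|\,\tilde R)\le a\}$ is compact for the topology of $\tilde{\mathsf W}_1$, where $\mathsf{KL}$ is the Kullback–Leibler divergence. For $(f,g,h)\in L^1(\mu)\times L^1(\mu;\mathbb R^{d_x})\times L^1(\nu)$ put $$D^\varepsilon(f,g,h)=\int f\,d\mu+\int h\,d\nu-\varepsilon\int e^{\frac1\varepsilon(f(u)+\langle g(u),x\rangle+h(x,y)-c(u,y))}\,dR(u,x,y)+\varepsilon\in[-\infty,\infty).$$ The dual problem is to maximize $D^\varepsilon$ over $L^1(\mu)\times L^1(\mu;\mathbb R^{d_x})\times L^1(\nu)$. Then a given $(f,g,h)\in L^1(\mu)\times L^1(\mu;\mathbb R^{d_x})\times L^1(\nu)$ solves the dual problem, i.e. attains the supremum, if and only if the following three equations hold, where it is part of each equation that the integral in it converges absolutely for almost every value of the free variable: $$f(u)=-\varepsilon\log\int_{\mathbb R^{d_x+d_y}}e^{\frac1\varepsilon(\langle g(u),x\rangle+h(x,y)-c(u,y))}\,d\nu(x,y)\quad\text{for }\mu\text{-a.e. }u,$$ $$\int_{\mathbb R^{d_x+d_y}}x\,e^{\frac1\varepsilon(\langle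 g(u),x\rangle+h(x,y)-c(u,y))}\,d\nu(x,y)=0\quad\text{for }\mu\text{-a.e. }u,$$ $$h(x,y)=-\varepsilon\log\int_{\mathbb R^{d_y}}e^{\frac1\varepsilon(f(u)+\langle g(u),x\rangle-c(u,y))}\,d\mu(u)\quad\text{for }\nu\text{-a.e. }(x,y).$$ -/

import Mathlib

open MeasureTheory InformationTheory
open scoped ENNReal

namespace VQR

/-- The Euclidean space `ℝ^d` with its standard norm. -/
abbrev Euc (d : ℕ) : Type := EuclideanSpace ℝ (Fin d)

/-- The space `ℝ^{dx + dy}` of pairs `(x, y)`; only its Borel σ-algebra (which is the product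
σ-algebra) is used, never a norm of the pair. -/
abbrev XY (dx dy : ℕ) : Type := Euc dx × Euc dy

/-- The space `ℝ^{dy} × ℝ^{dx + dy}` of triples `(u, x, y)`, written `(u, (x, y))`. -/
abbrev UXY (dx dy : ℕ) : Type := Euc dy × XY dx dy

/-- The quadratic cost `c(u, y) = ‖u - y‖² / 2`. -/
noncomputable def cost {dy : ℕ} (u y : Euc dy) : ℝ := (1 / 2) * ‖u - y‖ ^ 2

/-- The modified reference probability measure `dR̃ = α⁻¹ e^{-c/ε} d(μ ⊗ ν)`, where
`α = ∫ e^{-c/ε} d(μ ⊗ ν)` is the normalizing constant. -/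
noncomputable def refMeasure {dx dy : ℕ} (ε : ℝ) (μ : Measure (Euc dy))
    (ν : Measure (XY dx dy)) : Measure (UXY dx dy) :=
  (μ.prod ν).tilted fun p => -cost p.1 p.2.2 / ε

/-! ### The modified Wasserstein distance -/

/-- The metric `‖u - u'‖ ∧ 1 + ‖x - x'‖ + ‖y - y'‖ ∧ 1`. -/
noncomputable def modDist {dx dy : ℕ} (p q : UXY dx dy) : ℝ :=
  min ‖p.1 - q.1‖ 1 + ‖p.2.1 - q.2.1‖ + min ‖p.2.2 - q.2.2‖ 1

/-- `γ` is a coupling of `P` and `Q`, i.e. it has marginals `P` and `Q`. -/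
def IsCoupling {M : Type*} [MeasurableSpace M] (P Q : Measure M) (γ : Measure (M × M)) : Prop :=
  γ.map Prod.fst = P ∧ γ.map Prod.snd = Q

/-- The probability measures with a finite first moment for `modDist`. -/
def ModP1 (dx dy : ℕ) : Type :=
  {P : ProbabilityMeasure (UXY dx dy) //
    ∫⁻ p, ENNReal.ofReal (modDist p 0) ∂(P : Measure (UXY dx dy)) < ∞}

/-- The underlying measure of an element of `ModP1`. -/
noncomputable def ModP1.toMeasure {dx dy : ℕ} (P : ModP1 dx dy) : Measure (UXY dx dy) :=
  (P.1 : Measure (UXY dx dy))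

/-- The 1-Wasserstein distance for the metric `modDist`. -/
noncomputable def modW1 {dx dy : ℕ} (P Q : ModP1 dx dy) : ℝ≥0∞ :=
  ⨅ (γ : Measure (UXY dx dy × UXY dx dy)) (_ : IsCoupling P.toMeasure Q.toMeasure γ),
    ∫⁻ r, ENNReal.ofReal (modDist r.1 r.2) ∂γ

/-- The topology of the metric `modW1`: the one generated by its open balls. -/
@[reducible]
def modW1Topology (dx dy : ℕ) : TopologicalSpace (ModP1 dx dy) :=
  TopologicalSpace.generateFrom
    {B | ∃ (P : ModP1 dx dy) (r : ℝ≥0∞), B = {Q | modW1 P Q < r}}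

/-! ### The assumptions for duality -/

/-- The second moment matrix `E[X Xᵀ]`, for `(X, Y)` with law `ν`. -/
noncomputable def secondMoment {dx dy : ℕ} (ν : Measure (XY dx dy)) :
    Matrix (Fin dx) (Fin dx) ℝ :=
  Matrix.of fun i j => ∫ z, z.1 i * z.1 j ∂ν

/-- The duality assumptions: `E[X Xᵀ]` is invertible, and `Q ↦ KL(Q ‖ R̃)` is coercive in the
modified Wasserstein distance, i.e. all its sublevel sets are compact. -/
structure DualityAssumption {dx dy : ℕ} (ε : ℝ) (μ : Measure (Euc dy))
    (ν : Measure (XY dx dy)) : Prop where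
  isUnit_secondMoment : IsUnit (secondMoment ν)
  coercive : ∀ a : ℝ, 0 < a →
    @IsCompact (ModP1 dx dy) (modW1Topology dx dy)
      {Q | klDiv Q.toMeasure (refMeasure ε μ ν) ≤ ENNReal.ofReal a}

/-! ### The dual problem -/

/-- The penalty `ε ∫ exp((f(u) + ⟨g(u), x⟩ + h(x, y) - c(u, y)) / ε) d(μ ⊗ ν) - ε`, which is `+∞`
where the integral diverges. -/
noncomputable def penalty {dx dy : ℕ} (ε : ℝ) (μ : Measure (Euc dy)) (ν : Measure (XY dx dy))
    (f : Euc dy → ℝ) (g : Euc dy → Euc dx) (h : XY dx dy → ℝ) : EReal :=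
  (ε : EReal) * ((∫⁻ p, ENNReal.ofReal (Real.exp
    ((f p.1 + inner ℝ (g p.1) p.2.1 + h p.2 - cost p.1 p.2.2) / ε)) ∂(μ.prod ν) : ℝ≥0∞) : EReal)
    - (ε : EReal)

/-- The dual objective `∫ f dμ + ∫ h dν - penalty`, with values in `[-∞, ∞)`. -/
noncomputable def dualObjective {dx dy : ℕ} (ε : ℝ) (μ : Measure (Euc dy))
    (ν : Measure (XY dx dy))
    (f : Euc dy → ℝ) (g : Euc dy → Euc dx) (h : XY dx dy → ℝ) : EReal :=
  ((∫ u, f u ∂μ + ∫ z, h z ∂ν : ℝ) : EReal) - penalty ε μ ν f g h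

/-- The value of the dual problem: the supremum of the dual objective over all triples
`(f, g, h)` in `L¹(μ) × L¹(μ; ℝ^{dx}) × L¹(ν)`. -/
noncomputable def dualValue {dx dy : ℕ} (ε : ℝ) (μ : Measure (Euc dy))
    (ν : Measure (XY dx dy)) : EReal :=
  ⨆ (f : Euc dy → ℝ) (g : Euc dy → Euc dx) (h : XY dx dy → ℝ)
    (_ : Integrable f μ ∧ Integrable g μ ∧ Integrable h ν), dualObjective ε μ ν f g h

/-- An integrable triple `(f, g, h)` solves the dual problem: it attains the supremum. -/
def SolvesDual {dx dy : ℕ} (ε : ℝ) (μ : Measure (Euc dy)) (ν : Measure (XY dx dy))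
    (f : Euc dy → ℝ) (g : Euc dy → Euc dx) (h : XY dx dy → ℝ) : Prop :=
  (Integrable f μ ∧ Integrable g μ ∧ Integrable h ν) ∧
    dualObjective ε μ ν f g h = dualValue ε μ ν

end VQR

/-! Write `E` for `density ε f g h`. Moving `f(u)` resp. `h(x, y)` into the exponential turns the
first and third equations into the statement that `E dR` has marginals `μ` and `ν`; the second says
that `X` has conditional mean zero given `u` under `E dR`. These are the first-order conditions of a
concave problem. Necessity: `SolvesDual.first_variation` differentiates along directions bounded
above, for which `E e^{ts}` stays integrable. Multiples of indicators give the marginals. A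
perturbation of `g` is linear in `x`, hence unbounded, so it is paired with a perturbation `-‖e‖‖x‖`
of `h`. The second marginal, already known, makes `E‖x‖` integrable and cancels this compensator.
Sufficiency: `density_tangent_le` is integrated, first over `(x, y)` and then over `u`. This order
matters: `E⟨g' - g, x⟩` need not be integrable for the product measure, but on almost every fibre it
is, with integral zero. -/

namespace VQR

open Filter Topology

/-! ### Exponential integrals, Fubini with a prescribed marginal, one-sided differentiation. -/

section Abstract

variable {α β : Type*} [MeasurableSpace α] [MeasurableSpace β] {μ : Measure α} {ν : Measure β}

/-- An integral of an exponential equals one exactly if the additive constant is its normalizing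
logarithm. -/
lemma integrable_and_eq_neg_mul_log_iff [NeZero ν] {ε : ℝ} (hε : 0 < ε) (a : ℝ) (F : β → ℝ) :
    (Integrable (fun z => Real.exp (F z / ε)) ν ∧
        a = -ε * Real.log (∫ z, Real.exp (F z / ε) ∂ν)) ↔
      (Integrable (fun z => Real.exp ((a + F z) / ε)) ν ∧
        ∫ z, Real.exp ((a + F z) / ε) ∂ν = 1) := by
  have hexp : (fun z => Real.exp ((a + F z) / ε)) =
      fun z => Real.exp (a / ε) * Real.exp (F z / ε) := by
    funext z
    rw [add_div, Real.exp_add]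
  rw [hexp, integrable_const_mul_iff (Real.exp_pos _).ne'.isUnit, integral_const_mul]
  refine and_congr_right fun hF => ?_
  have hpos : 0 < ∫ z, Real.exp (F z / ε) ∂ν := integral_exp_pos hF
  constructor
  · intro h
    have : a / ε = -Real.log (∫ z, Real.exp (F z / ε) ∂ν) := by
      rw [div_eq_iff hε.ne']
      linarith
    rw [this, Real.exp_neg, Real.exp_log hpos, inv_mul_cancel₀ hpos.ne']
  · intro h
    have h2 := congrArg Real.log h
    rw [Real.log_mul (Real.exp_pos _).ne' hpos.ne', Real.log_exp, Real.log_one] at h2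
    have : a = ε * (a / ε) := by field_simp
    rw [this, eq_neg_of_add_eq_zero_left h2]
    ring

/-- Integrals of functions of the second variable against a density with second marginal `ν`. -/
lemma integrable_mul_snd_and_integral_eq [SFinite μ] [SFinite ν] {E : α × β → ℝ}
    (hE : AEStronglyMeasurable E (μ.prod ν)) (hE0 : ∀ p, 0 ≤ E p)
    (hmarg : ∀ᵐ z ∂ν, Integrable (fun u => E (u, z)) μ ∧ ∫ u, E (u, z) ∂μ = 1)
    {k : β → ℝ} (hk : Integrable k ν) :
    Integrable (fun p => E p * k p.2) (μ.prod ν) ∧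
      ∫ p, E p * k p.2 ∂(μ.prod ν) = ∫ z, k z ∂ν := by
  have hint : Integrable (fun p => E p * k p.2) (μ.prod ν) := by
    have hm : AEStronglyMeasurable (fun p => E p * k p.2) (μ.prod ν) :=
      hE.mul hk.aestronglyMeasurable.comp_snd
    -- Integrating over `u` first, `E ≥ 0` with fibre mass one leaves exactly `‖k z‖`.
    rw [integrable_prod_iff' hm]
    refine ⟨?_, hk.norm.congr ?_⟩
    · filter_upwards [hmarg] with z hz using hz.1.mul_const _
    · filter_upwards [hmarg] with z hz
      simp only [norm_mul, Real.norm_of_nonneg (hE0 _)]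
      rw [integral_mul_const, hz.2, one_mul]
  refine ⟨hint, ?_⟩
  rw [integral_prod_symm _ hint]
  refine integral_congr_ae ?_
  filter_upwards [hmarg] with z hz
  rw [integral_mul_const, hz.2, one_mul]

/-- Only an upper bound on `x` is needed, since the exponential has slope at most `e^C` on `(-∞,
C]`. This dominates difference quotients in directions unbounded below. -/
lemma abs_exp_sub_one_le_mul_exp {x C : ℝ} (hC : 0 ≤ C) (hx : x ≤ C) :
    |Real.exp x - 1| ≤ |x| * Real.exp C := by
  have h1 : x + 1 ≤ Real.exp x := Real.add_one_le_exp x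
  have h3 : 1 ≤ Real.exp C := Real.one_le_exp hC
  rcases le_total 0 x with h | h
  · have h2 : -x + 1 ≤ Real.exp (-x) := Real.add_one_le_exp (-x)
    have h4 : Real.exp (-x) * Real.exp x = 1 := by rw [← Real.exp_add]; simp
    have h5 : Real.exp x ≤ Real.exp C := Real.exp_le_exp.2 hx
    rw [abs_of_nonneg (by linarith), abs_of_nonneg h]
    nlinarith [Real.exp_pos x]
  · have h2 : Real.exp x ≤ 1 := Real.exp_le_one_iff.2 h
    rw [abs_of_nonpos (by linarith), abs_of_nonpos h]
    nlinarith

lemma tendsto_exp_mul_sub_one_div (s : ℝ) :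
    Tendsto (fun n : ℕ => (Real.exp (1 / ((n : ℝ) + 1) * s) - 1) / (1 / ((n : ℝ) + 1)))
      atTop (𝓝 s) := by
  have hd : HasDerivAt (fun t : ℝ => Real.exp (t * s)) s 0 := by
    simpa using ((hasDerivAt_id (0 : ℝ)).mul_const s).exp
  have ht : Tendsto (fun n : ℕ => 1 / ((n : ℝ) + 1)) atTop (𝓝[≠] 0) :=
    tendsto_nhdsWithin_iff.2 ⟨tendsto_one_div_add_atTop_nhds_zero_nat,
      Eventually.of_forall fun n => (by positivity : (1 / ((n : ℝ) + 1)) ≠ 0)⟩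
  refine (hd.tendsto_slope.comp ht).congr fun n => ?_
  simp [slope_def_field]

/-- Differentiation at `0⁺` of `t ↦ ∫ E e^{t s}` in a direction `s` that is bounded above. -/
lemma le_integral_mul_of_forall_le {E s : α → ℝ} (hE : Integrable E μ)
    (hs : AEStronglyMeasurable s μ) {C : ℝ} (hC : 0 ≤ C) (hsC : ∀ p, s p ≤ C)
    (hEs : Integrable (fun p => E p * s p) μ) {a : ℝ}
    (ha : ∀ t : ℝ, 0 < t → t ≤ 1 → Integrable (fun p => E p * Real.exp (t * s p)) μ →
      t * a ≤ ∫ p, E p * Real.exp (t * s p) ∂μ - ∫ p, E p ∂μ) :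
    a ≤ ∫ p, E p * s p ∂μ := by
  have hexpm (t : ℝ) : AEStronglyMeasurable (fun p => Real.exp (t * s p)) μ :=
    Real.continuous_exp.comp_aestronglyMeasurable (hs.const_mul t)
  have hts {t : ℝ} (ht0 : 0 < t) (ht1 : t ≤ 1) (p : α) : t * s p ≤ C :=
    (mul_le_mul_of_nonneg_left (hsC p) ht0.le).trans (mul_le_of_le_one_left hC ht1)
  have hint {t : ℝ} (ht0 : 0 < t) (ht1 : t ≤ 1) :
      Integrable (fun p => E p * Real.exp (t * s p)) μ := by
    refine (hE.mul_const (Real.exp C)).mono (hE.aestronglyMeasurable.mul (hexpm t))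
      (Eventually.of_forall fun p => ?_)
    rw [norm_mul, norm_mul, Real.norm_of_nonneg (Real.exp_pos _).le,
      Real.norm_of_nonneg (Real.exp_pos _).le]
    gcongr
    exact hts ht0 ht1 p
  have hn0 (n : ℕ) : 0 < 1 / ((n : ℝ) + 1) := by positivity
  have hn1 (n : ℕ) : 1 / ((n : ℝ) + 1) ≤ 1 := by
    rw [div_le_one (by positivity)]
    linarith [n.cast_nonneg (α := ℝ)]
  have hlim : Tendsto (fun n : ℕ => ∫ p, E p *
      ((Real.exp (1 / ((n : ℝ) + 1) * s p) - 1) / (1 / ((n : ℝ) + 1))) ∂μ)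
      atTop (𝓝 (∫ p, E p * s p ∂μ)) := by
    refine tendsto_integral_of_dominated_convergence (fun p => |E p * s p| * Real.exp C)
      (fun n => hE.aestronglyMeasurable.mul (((hexpm _).sub aestronglyMeasurable_const).mul_const _))
      (hEs.abs.mul_const _) (fun n => Eventually.of_forall fun p => ?_)
      (Eventually.of_forall fun p => (tendsto_exp_mul_sub_one_div (s p)).const_mul _)
    have h := abs_exp_sub_one_le_mul_exp hC (hts (hn0 n) (hn1 n) p)
    rw [abs_mul, abs_of_pos (hn0 n)] at h
    rw [Real.norm_eq_abs, abs_mul, abs_mul, abs_div, abs_of_pos (hn0 n), mul_assoc]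
    gcongr
    rw [div_le_iff₀ (hn0 n)]
    linarith
  refine ge_of_tendsto' hlim fun n => ?_
  have h := ha _ (hn0 n) (hn1 n) (hint (hn0 n) (hn1 n))
  rw [← integral_sub (hint (hn0 n) (hn1 n)) hE, mul_comm, ← le_div_iff₀ (hn0 n),
    ← integral_div] at h
  refine h.trans_eq (integral_congr_ae (Eventually.of_forall fun p => ?_))
  simp only
  ring

end Abstract

/-! ### The density and the dual objective. -/

section Dual

variable {dx dy : ℕ} {ε : ℝ} {μ : Measure (Euc dy)} {ν : Measure (XY dx dy)}
  {f φ : Euc dy → ℝ} {g ψ : Euc dy → Euc dx} {h k : XY dx dy → ℝ}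

/-- The density `e^{(f(u) + ⟨g(u), x⟩ + h(x, y) - c(u, y)) / ε}`. -/
noncomputable def density (ε : ℝ) (f : Euc dy → ℝ) (g : Euc dy → Euc dx) (h : XY dx dy → ℝ)
    (p : UXY dx dy) : ℝ :=
  Real.exp ((f p.1 + inner ℝ (g p.1) p.2.1 + h p.2 - cost p.1 p.2.2) / ε)

lemma density_pos (p : UXY dx dy) : 0 < density ε f g h p := Real.exp_pos _

/-- The exponent is affine in the potentials. Small `t` serves the first variation, `t = 1` the
tangent inequality. -/
lemma density_perturb (t : ℝ) (p : UXY dx dy) :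
    density ε (fun u => f u + t * φ u) (fun u => g u + t • ψ u) (fun z => h z + t * k z) p =
      density ε f g h p *
        Real.exp (t * ((φ p.1 + inner ℝ (ψ p.1) p.2.1 + k p.2) / ε)) := by
  rw [density, density, ← Real.exp_add, inner_add_left, real_inner_smul_left]
  congr 1
  ring

lemma aestronglyMeasurable_direction [SFinite μ] [SFinite ν] (hf : AEStronglyMeasurable f μ)
    (hg : AEStronglyMeasurable g μ) (hh : AEStronglyMeasurable h ν) :
    AEStronglyMeasurable (fun p : UXY dx dy => f p.1 + inner ℝ (g p.1) p.2.1 + h p.2)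
      (μ.prod ν) :=
  (hf.comp_fst.add (hg.comp_fst.inner
    (continuous_fst.comp continuous_snd).aestronglyMeasurable)).add hh.comp_snd

lemma aestronglyMeasurable_density [SFinite μ] [SFinite ν] (hf : AEStronglyMeasurable f μ)
    (hg : AEStronglyMeasurable g μ) (hh : AEStronglyMeasurable h ν) :
    AEStronglyMeasurable (density ε f g h) (μ.prod ν) := by
  have hc : Continuous fun p : UXY dx dy => cost p.1 p.2.2 := by
    unfold cost
    fun_prop
  exact Real.continuous_exp.comp_aestronglyMeasurable
    (((aestronglyMeasurable_direction hf hg hh).sub hc.aestronglyMeasurable).mul_const ε⁻¹)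

lemma dualObjective_eq_of_integrable (hE : Integrable (density ε f g h) (μ.prod ν)) :
    dualObjective ε μ ν f g h =
      ((∫ u, f u ∂μ + ∫ z, h z ∂ν - (ε * ∫ p, density ε f g h p ∂(μ.prod ν) - ε) : ℝ) :
        EReal) := by
  have hL : (∫⁻ p, ENNReal.ofReal (Real.exp
      ((f p.1 + inner ℝ (g p.1) p.2.1 + h p.2 - cost p.1 p.2.2) / ε)) ∂(μ.prod ν)) =
      ENNReal.ofReal (∫ p, density ε f g h p ∂(μ.prod ν)) :=
    (ofReal_integral_eq_lintegral_ofReal hE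
      (Eventually.of_forall fun p => (density_pos p).le)).symm
  rw [dualObjective, penalty, hL, EReal.coe_ennreal_ofReal,
    max_eq_left (integral_nonneg fun p => (density_pos p).le)]
  norm_cast

lemma dualObjective_eq_bot_of_not_integrable (hε : 0 < ε)
    (hm : AEStronglyMeasurable (density ε f g h) (μ.prod ν))
    (hE : ¬ Integrable (density ε f g h) (μ.prod ν)) :
    dualObjective ε μ ν f g h = ⊥ := by
  have hL : (∫⁻ p, ENNReal.ofReal (Real.exp
      ((f p.1 + inner ℝ (g p.1) p.2.1 + h p.2 - cost p.1 p.2.2) / ε)) ∂(μ.prod ν)) = ⊤ := by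
    by_contra hne
    exact hE ⟨hm, (hasFiniteIntegral_iff_ofReal
      (Eventually.of_forall fun p => (density_pos p).le)).2 (lt_top_iff_ne_top.2 hne)⟩
  rw [dualObjective, penalty, hL, EReal.coe_ennreal_top, EReal.coe_mul_top_of_pos hε,
    EReal.top_sub_coe, sub_eq_add_neg, EReal.neg_top, EReal.add_bot]

lemma solvesDual_iff (hf : Integrable f μ) (hg : Integrable g μ) (hh : Integrable h ν) :
    SolvesDual ε μ ν f g h ↔ ∀ f' g' h', Integrable f' μ → Integrable g' μ → Integrable h' ν →
      dualObjective ε μ ν f' g' h' ≤ dualObjective ε μ ν f g h := by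
  constructor
  · rintro ⟨-, hs⟩ f' g' h' hf' hg' hh'
    rw [hs]
    exact le_iSup_of_le f' (le_iSup_of_le g' (le_iSup_of_le h'
      (le_iSup_of_le ⟨hf', hg', hh'⟩ le_rfl)))
  · intro hle
    refine ⟨⟨hf, hg, hh⟩, le_antisymm ?_ ?_⟩
    · exact le_iSup_of_le f (le_iSup_of_le g (le_iSup_of_le h
        (le_iSup_of_le ⟨hf, hg, hh⟩ le_rfl)))
    · exact iSup_le fun f' => iSup_le fun g' => iSup_le fun h' => iSup_le fun hi =>
        hle f' g' h' hi.1 hi.2.1 hi.2.2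

/-! ### Necessity: first-order conditions at a maximizer. -/

variable [IsProbabilityMeasure μ] [IsProbabilityMeasure ν]

/-- Otherwise the objective is `⊥`, while zero potentials give a finite value because `e^{-c/ε} ≤
1`. -/
lemma SolvesDual.integrable_density (hs : SolvesDual ε μ ν f g h) (hε : 0 < ε) :
    Integrable (density ε f g h) (μ.prod ν) := by
  obtain ⟨⟨hf, hg, hh⟩, -⟩ := id hs
  by_contra hE
  have hle := (solvesDual_iff hf hg hh).1 hs (fun _ => 0) (fun _ => 0) (fun _ => 0)
    (integrable_const _) (integrable_const _) (integrable_const _)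
  have h0 : Integrable (density ε (fun _ => 0) (fun _ : Euc dy => (0 : Euc dx)) (fun _ => 0))
      (μ.prod ν) := by
    refine Integrable.of_bound (aestronglyMeasurable_density aestronglyMeasurable_const
      aestronglyMeasurable_const aestronglyMeasurable_const) 1 (Eventually.of_forall fun p => ?_)
    rw [Real.norm_of_nonneg (density_pos p).le, density, Real.exp_le_one_iff]
    have : 0 ≤ cost p.1 p.2.2 := by unfold cost; positivity
    simp only [inner_zero_left]
    exact div_nonpos_of_nonpos_of_nonneg (by linarith) hε.le
  rw [dualObjective_eq_bot_of_not_integrable hε (aestronglyMeasurable_density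
    hf.aestronglyMeasurable hg.aestronglyMeasurable hh.aestronglyMeasurable) hE,
    dualObjective_eq_of_integrable h0, le_bot_iff] at hle
  exact EReal.coe_ne_bot _ hle

/-- The first variation of the dual objective at a maximizer is nonpositive. -/
lemma SolvesDual.first_variation (hs : SolvesDual ε μ ν f g h) (hε : 0 < ε)
    (hφ : Integrable φ μ) (hψ : Integrable ψ μ) (hk : Integrable k ν) {C : ℝ} (hC : 0 ≤ C)
    (hle : ∀ p : UXY dx dy, φ p.1 + inner ℝ (ψ p.1) p.2.1 + k p.2 ≤ C)
    (hint : Integrable (fun p : UXY dx dy =>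
      density ε f g h p * (φ p.1 + inner ℝ (ψ p.1) p.2.1 + k p.2)) (μ.prod ν)) :
    ∫ u, φ u ∂μ + ∫ z, k z ∂ν ≤ ∫ p, density ε f g h p *
      (φ p.1 + inner ℝ (ψ p.1) p.2.1 + k p.2) ∂(μ.prod ν) := by
  obtain ⟨⟨hf, hg, hh⟩, -⟩ := id hs
  have hE := hs.integrable_density hε
  have key : (∫ u, φ u ∂μ + ∫ z, k z ∂ν) / ε ≤ ∫ p, density ε f g h p *
      ((φ p.1 + inner ℝ (ψ p.1) p.2.1 + k p.2) / ε) ∂(μ.prod ν) := by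
    refine le_integral_mul_of_forall_le hE
      ((aestronglyMeasurable_direction hφ.aestronglyMeasurable hψ.aestronglyMeasurable
        hk.aestronglyMeasurable).mul_const ε⁻¹) (div_nonneg hC hε.le)
      (fun p => div_le_div_of_nonneg_right (hle p) hε.le) ?_ ?_
    · refine (hint.div_const ε).congr (Eventually.of_forall fun p => ?_)
      simp only
      ring
    · intro t ht0 _ hti
      have hEt : density ε (fun u => f u + t * φ u) (fun u => g u + t • ψ u)
          (fun z => h z + t * k z) = fun p => density ε f g h p *
            Real.exp (t * ((φ p.1 + inner ℝ (ψ p.1) p.2.1 + k p.2) / ε)) :=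
        funext fun p => density_perturb t p
      have hcmp := (solvesDual_iff hf hg hh).1 hs _ _ _ (hf.add (hφ.const_mul t))
        (hg.add (hψ.smul t)) (hh.add (hk.const_mul t))
      simp only [Pi.add_def, Pi.smul_apply] at hcmp
      rw [dualObjective_eq_of_integrable hE, dualObjective_eq_of_integrable (by rwa [hEt]),
        EReal.coe_le_coe_iff, hEt, integral_add hf (hφ.const_mul t),
        integral_add hh (hk.const_mul t), integral_const_mul, integral_const_mul] at hcmp
      simp only [← div_eq_mul_inv]
      rw [← mul_div_assoc, div_le_iff₀ hε]
      linarith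
  have hdiv : ∫ p, density ε f g h p *
      ((φ p.1 + inner ℝ (ψ p.1) p.2.1 + k p.2) / ε) ∂(μ.prod ν) = (∫ p, density ε f g h p *
      (φ p.1 + inner ℝ (ψ p.1) p.2.1 + k p.2) ∂(μ.prod ν)) / ε := by
    rw [← integral_div]
    exact integral_congr_ae (Eventually.of_forall fun p => (mul_div_assoc _ _ _).symm)
  rw [hdiv] at key
  exact (div_le_div_iff_of_pos_right hε).1 key

lemma SolvesDual.fst_marginal (hs : SolvesDual ε μ ν f g h) (hε : 0 < ε) :
    ∀ᵐ u ∂μ, Integrable (fun z => density ε f g h (u, z)) ν ∧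
      ∫ z, density ε f g h (u, z) ∂ν = 1 := by
  have hE := hs.integrable_density hε
  have hfib : ∀ᵐ u ∂μ, Integrable (fun z => density ε f g h (u, z)) ν := hE.prod_right_ae
  have hone : (fun u => ∫ z, density ε f g h (u, z) ∂ν) =ᵐ[μ] fun _ => 1 := by
    refine Integrable.ae_eq_of_forall_setIntegral_eq _ _ hE.integral_prod_left
      (integrable_const 1) fun A hA _ => ?_
    have hvar (c : ℝ) : c * ∫ _ in A, (1 : ℝ) ∂μ ≤
        c * ∫ u in A, ∫ z, density ε f g h (u, z) ∂ν ∂μ := by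
      have hAE : Integrable (fun p : UXY dx dy =>
          density ε f g h p * A.indicator (fun _ => c) p.1) (μ.prod ν) := by
        refine hE.mul_bdd (c := |c|)
          ((measurable_const.indicator hA).comp measurable_fst).aestronglyMeasurable
          (Eventually.of_forall fun p => ?_)
        exact norm_indicator_le_norm_self (fun _ => c) p.1
      have hv := hs.first_variation hε (φ := A.indicator fun _ => c) (ψ := fun _ => 0)
        (k := fun _ => 0) ((integrable_const c).indicator hA) (integrable_const _)
        (integrable_const _) (abs_nonneg c) (fun p => by
          simpa using (le_abs_self _).trans (norm_indicator_le_norm_self (fun _ => c) p.1))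
        (by simpa using hAE)
      simp only [inner_zero_left, add_zero, integral_zero] at hv
      rw [integral_indicator hA, integral_prod _ hAE] at hv
      have hr : ∫ u, ∫ z, density ε f g h (u, z) * A.indicator (fun _ => c) u ∂ν ∂μ =
          c * ∫ u in A, ∫ z, density ε f g h (u, z) ∂ν ∂μ := by
        rw [← integral_const_mul, ← integral_indicator hA]
        refine integral_congr_ae (Eventually.of_forall fun u => ?_)
        simp only [integral_mul_const]
        by_cases hu : u ∈ A <;> simp [hu, mul_comm]
      rw [hr] at hv
      refine le_trans (le_of_eq ?_) hv
      rw [← integral_const_mul, mul_one]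
    -- The two signs turn the one-sided variation into an equality.
    linarith [hvar 1, hvar (-1)]
  filter_upwards [hfib, hone] with u hu hu1 using ⟨hu, hu1⟩

lemma SolvesDual.snd_marginal (hs : SolvesDual ε μ ν f g h) (hε : 0 < ε) :
    ∀ᵐ z ∂ν, Integrable (fun u => density ε f g h (u, z)) μ ∧
      ∫ u, density ε f g h (u, z) ∂μ = 1 := by
  have hE := hs.integrable_density hε
  have hfib : ∀ᵐ z ∂ν, Integrable (fun u => density ε f g h (u, z)) μ := hE.prod_left_ae
  have hone : (fun z => ∫ u, density ε f g h (u, z) ∂μ) =ᵐ[ν] fun _ => 1 := by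
    refine Integrable.ae_eq_of_forall_setIntegral_eq _ _ hE.integral_prod_right
      (integrable_const 1) fun A hA _ => ?_
    have hvar (c : ℝ) : c * ∫ _ in A, (1 : ℝ) ∂ν ≤
        c * ∫ z in A, ∫ u, density ε f g h (u, z) ∂μ ∂ν := by
      have hAE : Integrable (fun p : UXY dx dy =>
          density ε f g h p * A.indicator (fun _ => c) p.2) (μ.prod ν) := by
        refine hE.mul_bdd (c := |c|)
          ((measurable_const.indicator hA).comp measurable_snd).aestronglyMeasurable
          (Eventually.of_forall fun p => ?_)
        exact norm_indicator_le_norm_self (fun _ => c) p.2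
      have hv := hs.first_variation hε (φ := fun _ => 0) (ψ := fun _ => 0)
        (k := A.indicator fun _ => c) (integrable_const _) (integrable_const _)
        ((integrable_const c).indicator hA) (abs_nonneg c) (fun p => by
          simpa using (le_abs_self _).trans (norm_indicator_le_norm_self (fun _ => c) p.2))
        (by simpa using hAE)
      simp only [inner_zero_left, zero_add, integral_zero] at hv
      rw [integral_indicator hA, integral_prod_symm _ hAE] at hv
      have hr : ∫ z, ∫ u, density ε f g h (u, z) * A.indicator (fun _ => c) z ∂μ ∂ν =
          c * ∫ z in A, ∫ u, density ε f g h (u, z) ∂μ ∂ν := by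
        rw [← integral_const_mul, ← integral_indicator hA]
        refine integral_congr_ae (Eventually.of_forall fun z => ?_)
        simp only [integral_mul_const]
        by_cases hz : z ∈ A <;> simp [hz, mul_comm]
      rw [hr] at hv
      refine le_trans (le_of_eq ?_) hv
      rw [← integral_const_mul, mul_one]
    linarith [hvar 1, hvar (-1)]
  filter_upwards [hfib, hone] with z hz hz1 using ⟨hz, hz1⟩

/-- At a maximizer, the conditional mean of `X` vanishes. The direction `ψ` is compensated by
`-‖e‖ ‖x‖` in the variable `(x, y)`, so that no exponential moments are needed. -/
lemma SolvesDual.condMean (hs : SolvesDual ε μ ν f g h) (hε : 0 < ε)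
    (hx : Integrable (fun z : XY dx dy => z.1) ν) :
    ∀ᵐ u ∂μ, Integrable (fun z : XY dx dy => density ε f g h (u, z) • z.1) ν ∧
      ∫ z, density ε f g h (u, z) • z.1 ∂ν = 0 := by
  have hE := hs.integrable_density hε
  -- The second marginal is used here, with `k = ‖x‖`.
  obtain ⟨hEn, hEn_eq⟩ := integrable_mul_snd_and_integral_eq hE.aestronglyMeasurable
    (fun p => (density_pos p).le) (hs.snd_marginal hε) hx.norm
  have hxm : AEStronglyMeasurable (fun p : UXY dx dy => p.2.1) (μ.prod ν) :=
    (continuous_fst.comp continuous_snd).aestronglyMeasurable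
  have hEx : Integrable (fun p : UXY dx dy => density ε f g h p • p.2.1) (μ.prod ν) := by
    refine hEn.mono (hE.aestronglyMeasurable.smul hxm) (Eventually.of_forall fun p => ?_)
    rw [norm_smul, norm_mul, norm_norm]
  have hfib : ∀ᵐ u ∂μ, Integrable (fun z => density ε f g h (u, z) • z.1) ν := hEx.prod_right_ae
  have hzero : (fun u => ∫ z, density ε f g h (u, z) • z.1 ∂ν) =ᵐ[μ] 0 := by
    refine Integrable.ae_eq_zero_of_forall_setIntegral_eq_zero hEx.integral_prod_left
      fun A hA _ => ?_
    have hvar (e : Euc dx) :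
        0 ≤ inner ℝ e (∫ u in A, ∫ z, density ε f g h (u, z) • z.1 ∂ν ∂μ) := by
      have hEi : Integrable (fun p : UXY dx dy =>
          density ε f g h p * inner ℝ (A.indicator (fun _ => e) p.1) p.2.1) (μ.prod ν) := by
        refine (hEn.const_mul ‖e‖).mono (hE.aestronglyMeasurable.mul
          (AEStronglyMeasurable.inner ((measurable_const.indicator hA).comp
            measurable_fst).aestronglyMeasurable hxm)) (Eventually.of_forall fun p => ?_)
        rw [norm_mul, norm_mul, norm_mul, norm_norm, norm_norm, mul_left_comm]
        gcongr
        refine (norm_inner_le_norm _ _).trans ?_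
        gcongr
        exact norm_indicator_le_norm_self (fun _ => e) p.1
      have hk : Integrable (fun z : XY dx dy => -(‖e‖ * ‖z.1‖)) ν := (hx.norm.const_mul _).neg
      have hEk : Integrable (fun p : UXY dx dy => density ε f g h p * -(‖e‖ * ‖p.2.1‖))
          (μ.prod ν) := by
        refine (hEn.const_mul (-‖e‖)).congr (Eventually.of_forall fun p => ?_)
        simp only
        ring
      have hv := hs.first_variation hε (φ := fun _ => 0) (ψ := A.indicator fun _ => e)
        (k := fun z => -(‖e‖ * ‖z.1‖)) (integrable_const _)
        ((integrable_const e).indicator hA) hk le_rfl (fun p => by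
          have h1 := (real_inner_le_norm (A.indicator (fun _ => e) p.1) p.2.1)
          have h2 := mul_le_mul_of_nonneg_right
            (norm_indicator_le_norm_self (s := A) (fun _ => e) p.1) (norm_nonneg p.2.1)
          linarith)
        (by
          refine (hEi.add hEk).congr (Eventually.of_forall fun p => ?_)
          simp only [Pi.add_apply]
          ring)
      have hsplit : ∫ p : UXY dx dy, density ε f g h p *
          (0 + inner ℝ (A.indicator (fun _ => e) p.1) p.2.1 + -(‖e‖ * ‖p.2.1‖)) ∂(μ.prod ν) =
          ∫ p : UXY dx dy, density ε f g h p *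
            inner ℝ (A.indicator (fun _ => e) p.1) p.2.1 ∂(μ.prod ν) -
          ‖e‖ * ∫ z, ‖z.1‖ ∂ν := by
        rw [← hEn_eq, ← integral_const_mul, ← integral_sub hEi (hEn.const_mul _)]
        refine integral_congr_ae (Eventually.of_forall fun p => ?_)
        simp only
        ring
      -- Both sides of `hv` now contain `-‖e‖ ∫ ‖x‖ dν`, which cancels.
      rw [hsplit, integral_zero, integral_neg, integral_const_mul] at hv
      have hnn : 0 ≤ ∫ p : UXY dx dy, density ε f g h p *
            inner ℝ (A.indicator (fun _ => e) p.1) p.2.1 ∂(μ.prod ν) := by linarith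
      rw [integral_prod _ hEi] at hnn
      refine hnn.trans_eq ?_
      rw [← integral_inner hEx.integral_prod_left.integrableOn, ← integral_indicator hA]
      refine integral_congr_ae ?_
      filter_upwards [hfib] with u hu
      by_cases huA : u ∈ A
      · simp only [huA, Set.indicator_of_mem]
        rw [← integral_inner hu]
        simp only [real_inner_smul_right]
      · simp [huA]
    -- Testing with minus the vector itself gives `0 ≤ -‖v‖²`.
    have h0 := hvar (-(∫ u in A, ∫ z, density ε f g h (u, z) • z.1 ∂ν ∂μ))
    rw [inner_neg_left, real_inner_self_eq_norm_sq] at h0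
    rw [← norm_eq_zero, ← sq_eq_zero_iff]
    exact le_antisymm (by linarith) (sq_nonneg _)
  filter_upwards [hfib, hzero] with u hu hu0 using ⟨hu, hu0⟩

/-! ### Sufficiency: concavity. -/

/-- The tangent inequality of the exponential at `density ε f g h`. -/
lemma density_tangent_le (f' : Euc dy → ℝ) (g' : Euc dy → Euc dx)
    (h' : XY dx dy → ℝ) (p : UXY dx dy) :
    density ε f g h p * (1 + (f' p.1 - f p.1 + inner ℝ (g' p.1 - g p.1) p.2.1 +
      (h' p.2 - h p.2)) / ε) ≤ density ε f' g' h' p := by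
  have hp := density_perturb (ε := ε) (f := f) (g := g) (h := h) (φ := fun u => f' u - f u)
    (ψ := fun u => g' u - g u) (k := fun z => h' z - h z) 1 p
  simp only [one_mul, one_smul, add_sub_cancel] at hp
  rw [hp]
  refine mul_le_mul_of_nonneg_left ?_ (density_pos p).le
  rw [add_comm]
  exact Real.add_one_le_exp _

lemma solvesDual_of_marginals (hε : 0 < ε)
    (hf : Integrable f μ) (hg : Integrable g μ) (hh : Integrable h ν)
    (h1 : ∀ᵐ u ∂μ, Integrable (fun z => density ε f g h (u, z)) ν ∧
      ∫ z, density ε f g h (u, z) ∂ν = 1)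
    (h2 : ∀ᵐ u ∂μ, Integrable (fun z : XY dx dy => density ε f g h (u, z) • z.1) ν ∧
      ∫ z, density ε f g h (u, z) • z.1 ∂ν = 0)
    (h3 : ∀ᵐ z ∂ν, Integrable (fun u => density ε f g h (u, z)) μ ∧
      ∫ u, density ε f g h (u, z) ∂μ = 1) :
    SolvesDual ε μ ν f g h := by
  refine (solvesDual_iff hf hg hh).2 fun f' g' h' hf' hg' hh' => ?_
  have hm (f : Euc dy → ℝ) (g : Euc dy → Euc dx) (h : XY dx dy → ℝ)
      (hf : Integrable f μ) (hg : Integrable g μ) (hh : Integrable h ν) :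
      AEStronglyMeasurable (density ε f g h) (μ.prod ν) :=
    aestronglyMeasurable_density hf.aestronglyMeasurable hg.aestronglyMeasurable
      hh.aestronglyMeasurable
  by_cases hE' : Integrable (density ε f' g' h') (μ.prod ν)
  swap
  · rw [dualObjective_eq_bot_of_not_integrable hε (hm _ _ _ hf' hg' hh') hE']
    exact bot_le
  -- `k = 1` yields both integrability and total mass one of the density.
  have hEmass := integrable_mul_snd_and_integral_eq (hm f g h hf hg hh)
    (fun p => (density_pos p).le) h3 (integrable_const (1 : ℝ))
  simp only [mul_one, integral_const, probReal_univ, smul_eq_mul] at hEmass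
  obtain ⟨hE, hE1⟩ := hEmass
  obtain ⟨hEk, hEk_eq⟩ := integrable_mul_snd_and_integral_eq (hm f g h hf hg hh)
    (fun p => (density_pos p).le) h3 (hh'.sub hh)
  simp only [Pi.sub_apply] at hEk hEk_eq
  rw [dualObjective_eq_of_integrable hE', dualObjective_eq_of_integrable hE,
    EReal.coe_le_coe_iff, hE1]
  have hfibk : ∀ᵐ u ∂μ, Integrable (fun z => density ε f g h (u, z) * (h' z - h z)) ν :=
    hEk.prod_right_ae
  have hfib' : ∀ᵐ u ∂μ, Integrable (fun z => density ε f' g' h' (u, z)) ν := hE'.prod_right_ae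
  -- The `g`-term is removed fibrewise by `h2`; what remains is integrable in `u`.
  have hfiber : ∀ᵐ u ∂μ, 1 + ((f' u - f u) +
      ∫ z, density ε f g h (u, z) * (h' z - h z) ∂ν) / ε ≤
        ∫ z, density ε f' g' h' (u, z) ∂ν := by
    filter_upwards [h1, h2, hfibk, hfib'] with u hu1 hu2 huk hu'
    have hin : Integrable (fun z => inner ℝ (g' u - g u) (density ε f g h (u, z) • z.1)) ν :=
      hu2.1.const_inner _
    have hin0 : ∫ z, inner ℝ (g' u - g u) (density ε f g h (u, z) • z.1) ∂ν = 0 := by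
      rw [integral_inner hu2.1, hu2.2, inner_zero_right]
    have hrest : Integrable (fun z => inner ℝ (g' u - g u) (density ε f g h (u, z) • z.1) / ε +
        density ε f g h (u, z) * (h' z - h z) / ε) ν := (hin.div_const ε).add (huk.div_const ε)
    have hsum := (hu1.1.mul_const (1 + (f' u - f u) / ε)).add hrest
    have heq : ∫ z, (density ε f g h (u, z) * (1 + (f' u - f u) / ε) +
        (inner ℝ (g' u - g u) (density ε f g h (u, z) • z.1) / ε +
          density ε f g h (u, z) * (h' z - h z) / ε)) ∂ν =
        1 + ((f' u - f u) + ∫ z, density ε f g h (u, z) * (h' z - h z) ∂ν) / ε := by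
      rw [integral_add (hu1.1.mul_const _) hrest,
        integral_add (hin.div_const ε) (huk.div_const ε), integral_mul_const, integral_div,
        integral_div, hin0, hu1.2]
      ring
    rw [← heq]
    refine integral_mono hsum hu' fun z => ?_
    refine le_trans (le_of_eq ?_) (density_tangent_le (f := f) (g := g) (h := h) f' g' h' (u, z))
    simp only [real_inner_smul_right]
    ring
  have hIk : Integrable (fun u => ∫ z, density ε f g h (u, z) * (h' z - h z) ∂ν) μ :=
    hEk.integral_prod_left
  have hmono := integral_mono_ae
    ((integrable_const (1 : ℝ)).add (((hf'.sub hf).add hIk).div_const ε))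
    hE'.integral_prod_left hfiber
  have hleft : ∫ u, (1 + ((f' u - f u) +
      ∫ z, density ε f g h (u, z) * (h' z - h z) ∂ν) / ε) ∂μ =
      1 + ((∫ u, f' u ∂μ - ∫ u, f u ∂μ) + (∫ z, h' z ∂ν - ∫ z, h z ∂ν)) / ε := by
    have hdf : Integrable (fun u => f' u - f u) μ := hf'.sub hf
    have hdiv : Integrable (fun u => ((f' u - f u) +
        ∫ z, density ε f g h (u, z) * (h' z - h z) ∂ν) / ε) μ := (hdf.add hIk).div_const ε
    rw [integral_add (integrable_const _) hdiv, integral_div, integral_add hdf hIk,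
      ← integral_sub hh' hh, ← hEk_eq, integral_prod _ hEk, ← integral_sub hf' hf]
    simp
  have hfin : 1 + ((∫ u, f' u ∂μ - ∫ u, f u ∂μ) + (∫ z, h' z ∂ν - ∫ z, h z ∂ν)) / ε ≤
      ∫ p, density ε f' g' h' p ∂(μ.prod ν) := by
    rw [← hleft, integral_prod _ hE']
    exact hmono
  have hscale := mul_le_mul_of_nonneg_left hfin hε.le
  rw [mul_add, mul_div_cancel₀ _ hε.ne'] at hscale
  linarith

end Dual

end VQR

/-! ### Translation between the equations and the marginal conditions. -/

theorem mainTheorem9 {dx dy : ℕ}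
    (μ : Measure (VQR.Euc dy)) [IsProbabilityMeasure μ]
    (ν : Measure (VQR.XY dx dy)) [IsProbabilityMeasure ν]
    (hμ : Integrable (fun u => ‖u‖ ^ 2) μ)
    (hν : Integrable (fun z => ‖z.1‖ ^ 2 + ‖z.2‖ ^ 2) ν)
    (hX : ∫ z, z.1 ∂ν = 0)
    (ε : ℝ) (hε : 0 < ε)
    (hA : VQR.DualityAssumption ε μ ν)
    (f : VQR.Euc dy → ℝ) (g : VQR.Euc dy → VQR.Euc dx) (h : VQR.XY dx dy → ℝ)
    (hf : Integrable f μ) (hg : Integrable g μ) (hh : Integrable h ν) :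
    VQR.SolvesDual ε μ ν f g h ↔
      (∀ᵐ u ∂μ,
        Integrable
          (fun z => Real.exp ((inner ℝ (g u) z.1 + h z - VQR.cost u z.2) / ε)) ν ∧
        f u = -ε * Real.log
          (∫ z, Real.exp ((inner ℝ (g u) z.1 + h z - VQR.cost u z.2) / ε) ∂ν)) ∧
      (∀ᵐ u ∂μ,
        Integrable
          (fun z => Real.exp ((inner ℝ (g u) z.1 + h z - VQR.cost u z.2) / ε) • z.1) ν ∧
        ∫ z, Real.exp ((inner ℝ (g u) z.1 + h z - VQR.cost u z.2) / ε) • z.1 ∂ν = 0) ∧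
      (∀ᵐ z ∂ν,
        Integrable
          (fun u => Real.exp ((f u + inner ℝ (g u) z.1 - VQR.cost u z.2) / ε)) μ ∧
        h z = -ε * Real.log
          (∫ u, Real.exp ((f u + inner ℝ (g u) z.1 - VQR.cost u z.2) / ε) ∂μ)) := by
  have hx : Integrable (fun z : VQR.XY dx dy => z.1) ν := by
    refine ((integrable_const (1 : ℝ)).add hν).mono continuous_fst.aestronglyMeasurable
      (Filter.Eventually.of_forall fun z => ?_)
    refine le_trans ?_ (le_abs_self _)
    simp only [Pi.add_apply]
    nlinarith [sq_nonneg (‖z.1‖ - 1), sq_nonneg ‖z.2‖, sq_nonneg ‖z.1‖]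
  have e1 (u : VQR.Euc dy) (z : VQR.XY dx dy) : VQR.density ε f g h (u, z) =
      Real.exp ((f u + (inner ℝ (g u) z.1 + h z - VQR.cost u z.2)) / ε) := by
    rw [VQR.density]
    congr 2
    ring
  have e2 (u : VQR.Euc dy) (z : VQR.XY dx dy) : VQR.density ε f g h (u, z) • z.1 =
      Real.exp (f u / ε) •
        Real.exp ((inner ℝ (g u) z.1 + h z - VQR.cost u z.2) / ε) • z.1 := by
    rw [e1, smul_smul, ← Real.exp_add, ← add_div]
  have e3 (u : VQR.Euc dy) (z : VQR.XY dx dy) : VQR.density ε f g h (u, z) =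
      Real.exp ((h z + (f u + inner ℝ (g u) z.1 - VQR.cost u z.2)) / ε) := by
    rw [VQR.density]
    congr 2
    ring
  simp only [VQR.integrable_and_eq_neg_mul_log_iff hε, ← e1, ← e3]
  -- The missing factor `e^{f(u)/ε}` is a nonzero constant on the fibre, so it affects neither
  -- integrability nor vanishing.
  have hmid (u : VQR.Euc dy) :
      (Integrable
          (fun z => Real.exp ((inner ℝ (g u) z.1 + h z - VQR.cost u z.2) / ε) • z.1) ν ∧
        ∫ z, Real.exp ((inner ℝ (g u) z.1 + h z - VQR.cost u z.2) / ε) • z.1 ∂ν = 0) ↔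
      (Integrable (fun z : VQR.XY dx dy => VQR.density ε f g h (u, z) • z.1) ν ∧
        ∫ z, VQR.density ε f g h (u, z) • z.1 ∂ν = 0) := by
    simp only [e2]
    rw [integral_smul, smul_eq_zero_iff_right (Real.exp_pos _).ne']
    refine and_congr_left fun _ => ?_
    exact (integrable_fun_smul_iff (Real.exp_pos _).ne' _).symm
  simp only [hmid]
  exact ⟨fun hs => ⟨hs.fst_marginal hε, hs.condMean hε hx, hs.snd_marginal hε⟩,
    fun ⟨h1, h2, h3⟩ => VQR.solvesDual_of_marginals hε hf hg hh h1 h2 h3⟩
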